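/- All graphs are finite and simple. A graph $G$ is \emph{1-perfectly orientable} if its edges can be oriented, each in exactly one direction, so that for every vertex $v$ the out-neighborhood of $v$ is a clique in $G$. A function $f:\mathbb{N}\to\mathbb{N}$ is a \emph{$(\mathrm{tw},\omega)$-binding function} for a class $\mathcal{G}$ of graphs if $\mathrm{tw}(G')\le f(\omega(G'))$ for every $G\in\mathcal{G}$ and every induced subgraph $G'$ of $G$, where $\mathrm{tw}$ denotes treewidth and $\omega$ the clique number; the class $\mathcal{G}$ is \emph{$(\mathrm{tw},\omega)$-bounded} if it has such a function. Let $R(k,\ell)$ be the Ramsey number, that is, the least positive integer $n$ such that every graph with at least $n$ vertices contains a clique of size $k$ or an independent set of size $\ell$. Corollary. The class of 1-perfectly orientable graphs is $(\mathrm{tw},\omega)$-bounded, with binding function \[ f(k)=\max\{k,\,2R(k+1,3)-2\}-1 \qquad (k\ge 1). \] (For the graph with no vertices, whose clique number is $0$, we put $\mathrm{tw}=0$ and $f(0)=0$.) This answers affirmatively a question of Brešar, Hartinger, Kos and Milanič, who asked whether this class is $(\mathrm{tw},\omega)$-bounded. -/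

import Mathlib

universe u

/-- `n` is a Ramsey bound for `(k, l)`: every finite graph with at least `n` vertices contains a
clique of size `k` or an independent set of size `l`. -/
def IsRamseyBound (k l n : ℕ) : Prop :=
  ∀ (V : Type) [Fintype V] (G : SimpleGraph V), n ≤ Fintype.card V →
    (∃ s : Finset V, G.IsNClique k s) ∨ (∃ s : Finset V, G.IsNIndepSet l s)

/-- The Ramsey number `R(k, l)`: the least positive integer `n` such that every graph with at least
`n` vertices contains a clique of size `k` or an independent set of size `l`. -/
noncomputable def ramseyNumber (k l : ℕ) : ℕ :=
  sInf {n : ℕ | 0 < n ∧ IsRamseyBound k l n}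

/-- Ramsey's theorem, inside a finite set of vertices. -/
theorem exists_ramsey_finset (k l : ℕ) : ∃ n : ℕ, 0 < n ∧
    ∀ (V : Type) (G : SimpleGraph V) (A : Finset V), n ≤ A.card →
      (∃ s ⊆ A, G.IsNClique k s) ∨ (∃ s ⊆ A, G.IsNIndepSet l s) := by
  classical
  induction k generalizing l with
  | zero =>
    exact ⟨1, one_pos, fun V G A _ => Or.inl ⟨∅, by simp, by simp⟩⟩
  | succ k ihk =>
    induction l with
    | zero =>
      exact ⟨1, one_pos, fun V G A _ => Or.inr ⟨∅, by simp, by simp [SimpleGraph.isNIndepSet_iff]⟩⟩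
    | succ l ihl =>
      obtain ⟨n₁, hn₁, h₁⟩ := ihk (l + 1)
      obtain ⟨n₂, hn₂, h₂⟩ := ihl
      refine ⟨n₁ + n₂, by omega, fun V G A hA => ?_⟩
      obtain ⟨v, hv⟩ : A.Nonempty := Finset.card_pos.mp (by omega)
      have hc := Finset.card_filter_add_card_filter_not (s := A.erase v) (G.Adj v)
      rw [Finset.card_erase_of_mem hv] at hc
      have hcase : n₁ ≤ ((A.erase v).filter (G.Adj v)).card ∨
          n₂ ≤ ((A.erase v).filter (fun w => ¬ G.Adj v w)).card := by omega
      rcases hcase with h | h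
      · rcases h₁ V G _ h with ⟨s, hs, hcl⟩ | ⟨s, hs, hi⟩
        · refine Or.inl ⟨insert v s, ?_, hcl.insert fun w hw => (Finset.mem_filter.mp (hs hw)).2⟩
          intro w hw
          rcases Finset.mem_insert.mp hw with rfl | hw
          · exact hv
          · exact Finset.mem_of_mem_erase (Finset.mem_filter.mp (hs hw)).1
        · exact Or.inr ⟨s, fun w hw =>
            Finset.mem_of_mem_erase (Finset.mem_filter.mp (hs hw)).1, hi⟩
      · rcases h₂ V G _ h with ⟨s, hs, hcl⟩ | ⟨s, hs, hi⟩
        · exact Or.inl ⟨s, fun w hw =>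
            Finset.mem_of_mem_erase (Finset.mem_filter.mp (hs hw)).1, hcl⟩
        · refine Or.inr ⟨insert v s, ?_, ?_⟩
          · intro w hw
            rcases Finset.mem_insert.mp hw with rfl | hw
            · exact hv
            · exact Finset.mem_of_mem_erase (Finset.mem_filter.mp (hs hw)).1
          · rw [← SimpleGraph.isNClique_compl] at hi ⊢
            refine hi.insert fun w hw => ?_
            have hw' := Finset.mem_filter.mp (hs hw)
            exact (SimpleGraph.compl_adj _ _ _).mpr ⟨(Finset.ne_of_mem_erase hw'.1).symm, hw'.2⟩

/-- Ramsey's theorem: the set whose infimum is `ramseyNumber k l` is nonempty, so `ramseyNumber k l`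
is its least element. -/
theorem ramseyNumber_isLeast (k l : ℕ) :
    IsLeast {n : ℕ | 0 < n ∧ IsRamseyBound k l n} (ramseyNumber k l) := by
  have hne : {n : ℕ | 0 < n ∧ IsRamseyBound k l n}.Nonempty := by
    obtain ⟨n, hn, h⟩ := exists_ramsey_finset k l
    refine ⟨n, hn, fun V _ G hc => ?_⟩
    rcases h V G Finset.univ (by simpa using hc) with ⟨s, -, hs⟩ | ⟨s, -, hs⟩
    · exact Or.inl ⟨s, hs⟩
    · exact Or.inr ⟨s, hs⟩
  exact ⟨Nat.sInf_mem hne, fun _ hn => Nat.sInf_le hn⟩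

/-- A tree decomposition of `G`: a finite tree together with a finite set of vertices of `G`
(a bag) for each of its nodes. -/
structure TreeDecomposition {V : Type u} (G : SimpleGraph V) where
  /-- the nodes of the tree -/
  Node : Type
  [fintypeNode : Fintype Node]
  /-- the tree -/
  tree : SimpleGraph Node
  isTree : tree.IsTree
  /-- the bags -/
  bag : Node → Finset V
  /-- every vertex lies in some bag -/
  vertex_mem : ∀ v : V, ∃ t, v ∈ bag t
  /-- both ends of every edge lie in a common bag -/
  edge_mem : ∀ u v : V, G.Adj u v → ∃ t, u ∈ bag t ∧ v ∈ bag t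
  /-- the nodes whose bags contain a given vertex induce a connected subtree -/
  connected : ∀ v : V, (tree.induce {t | v ∈ bag t}).Connected

attribute [instance] TreeDecomposition.fintypeNode

/-- The width of a tree decomposition: the maximum size of a bag, minus one. (The subtraction is
truncated only if all bags are empty, which happens only for the graph with no vertices.) -/
def TreeDecomposition.width {V : Type u} {G : SimpleGraph V} (D : TreeDecomposition G) : ℕ :=
  (Finset.univ.sup fun t : D.Node => (D.bag t).card) - 1

/-- The treewidth of a finite graph: the minimum width of a tree decomposition. -/
noncomputable def treewidth {V : Type u} (G : SimpleGraph V) : ℕ :=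
  sInf {w : ℕ | ∃ D : TreeDecomposition G, D.width = w}

/-- A finite graph has a tree decomposition, with a single bag. -/
theorem nonempty_treeDecomposition {V : Type u} [Finite V] (G : SimpleGraph V) :
    Nonempty (TreeDecomposition G) := by
  classical
  cases nonempty_fintype V
  exact ⟨{ Node := Unit
           tree := ⊥
           isTree := SimpleGraph.IsTree.of_subsingleton
           bag := fun _ => Finset.univ
           vertex_mem := fun v => ⟨(), Finset.mem_univ v⟩
           edge_mem := fun u v _ => ⟨(), Finset.mem_univ u, Finset.mem_univ v⟩
           connected := fun v =>
             { preconnected := fun a b => by rw [Subsingleton.elim a b]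
               nonempty := ⟨⟨(), Finset.mem_univ v⟩⟩ } }⟩

/-- The minimum in the definition of the treewidth of a finite graph is attained. -/
theorem treewidth_isLeast {V : Type u} [Finite V] (G : SimpleGraph V) :
    IsLeast {w : ℕ | ∃ D : TreeDecomposition G, D.width = w} (treewidth G) := by
  obtain ⟨D⟩ := nonempty_treeDecomposition G
  exact ⟨Nat.sInf_mem ⟨D.width, D, rfl⟩, fun _ hn => Nat.sInf_le hn⟩

/-- `D` is an orientation of `G`: every edge of `G` receives exactly one of its two directions. -/
structure IsOrientation {V : Type u} (D : Digraph V) (G : SimpleGraph V) : Prop where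
  adj_iff : ∀ u v : V, G.Adj u v ↔ D.Adj u v ∨ D.Adj v u
  asymm : ∀ u v : V, D.Adj u v → ¬ D.Adj v u

/-- `G` is 1-perfectly orientable: it has an orientation in which the out-neighborhood of every
vertex is a clique of `G`. -/
def IsOnePerfectlyOrientable {V : Type u} (G : SimpleGraph V) : Prop :=
  ∃ D : Digraph V, IsOrientation D G ∧ ∀ v : V, G.IsClique {w | D.Adj v w}

/-- `f` is a `(tw, ω)`-binding function for the class of finite graphs with the property `𝒢`. -/
def IsTwOmegaBindingFunction (𝒢 : ∀ {V : Type u}, SimpleGraph V → Prop) (f : ℕ → ℕ) : Prop :=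
  ∀ (V : Type u) [Finite V] (G : SimpleGraph V), 𝒢 G →
    ∀ s : Set V, treewidth (G.induce s) ≤ f (G.induce s).cliqueNum

/-- The class of finite graphs with the property `𝒢` is `(tw, ω)`-bounded. -/
def IsTwOmegaBounded (𝒢 : ∀ {V : Type u}, SimpleGraph V → Prop) : Prop :=
  ∃ f : ℕ → ℕ, IsTwOmegaBindingFunction 𝒢 f

/-! The stronger bound `tw ≤ 4ω - 1` holds. Two disjoint cliques of size `k` give `R(k+1,3) ≥ 2k+1`,
so `4k ≤ 2R(k+1,3) - 2`, and 1-perfect orientations restrict to induced subgraphs.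

Fix such an orientation. The boundary of a connected set `F` splits into the vertices with an arc
into `F` and those that only receive arcs from `F`. The second part is always a clique
(`isClique_outBoundary`). Call `F` good if the first part is one too; its boundary then has at most
`2ω` vertices.

The decomposition grows by exploration, keeping every unexplored component good and its boundary
inside one bag. For a good component `C`, a nonempty `X ⊆ C` is needed such that the boundary of `C`
together with `X` has at most `4ω` vertices and the components of `C \ X` are good. Unless `C` is a
clique complete to its boundary, `X` is the part in `C` of the boundary of a component `E` of the
non-neighbors in `C` of some vertex. For the other components of `C \ X` the key is that a vertex
cannot send arcs to two separated sets, so it only receives arcs from `E`. -/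

/-! ### Attaching a leaf to a tree -/

section LeafExtension

variable {N : Type*}

/-- The graph obtained from `T` by attaching a new leaf `none` to the vertex `t`. -/
def SimpleGraph.addLeaf (T : SimpleGraph N) (t : N) : SimpleGraph (Option N) where
  Adj a b := (∃ x y, T.Adj x y ∧ a = some x ∧ b = some y) ∨
    (a = none ∧ b = some t) ∨ (a = some t ∧ b = none)
  symm := ⟨by
    rintro a b (⟨x, y, h, rfl, rfl⟩ | ⟨rfl, rfl⟩ | ⟨rfl, rfl⟩)
    · exact Or.inl ⟨y, x, h.symm, rfl, rfl⟩
    · exact Or.inr (Or.inr ⟨rfl, rfl⟩)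
    · exact Or.inr (Or.inl ⟨rfl, rfl⟩)⟩
  loopless := ⟨by
    rintro a (⟨x, y, h, rfl, hy⟩ | ⟨rfl, h⟩ | ⟨rfl, h⟩)
    · exact h.ne (Option.some_injective _ hy)
    · simp at h
    · simp at h⟩

theorem SimpleGraph.addLeaf_induce_image_some_connected {T : SimpleGraph N} {t : N} {A : Set N}
    (h : (T.induce A).Connected) : ((T.addLeaf t).induce (some '' A)).Connected := by
  let f : T.induce A →g (T.addLeaf t).induce (some '' A) :=
    { toFun := fun x => ⟨some x.1, x.1, x.2, rfl⟩
      map_rel' := fun {x y} hxy => Or.inl ⟨x.1, y.1, hxy, rfl, rfl⟩ }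
  refine h.map f ?_
  rintro ⟨_, x, hx, rfl⟩
  exact ⟨⟨x, hx⟩, rfl⟩

theorem SimpleGraph.addLeaf_induce_insert_none_connected {T : SimpleGraph N} {t : N} {A : Set N}
    (h : (T.induce A).Connected) (ht : t ∈ A) :
    ((T.addLeaf t).induce (insert none (some '' A))).Connected := by
  have h1 := (SimpleGraph.addLeaf_induce_image_some_connected (t := t) h).preconnected
  have h2 := (SimpleGraph.induce_pair_connected_of_adj
    (G := T.addLeaf t) (u := none) (v := some t) (Or.inr (Or.inl ⟨rfl, rfl⟩))).preconnected
  have h3 := SimpleGraph.induce_union_connected h2 h1 ⟨some t, by simp, t, ht, rfl⟩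
  have he : ({none, some t} ∪ some '' A : Set (Option N)) = insert none (some '' A) := by
    ext x
    cases x <;> simp
    rintro rfl
    exact ht
  rwa [he] at h3

/-- A finite tree is a connected graph with one edge fewer than vertices; a leaf adds one of each.
-/
theorem SimpleGraph.IsTree.addLeaf [Finite N] {T : SimpleGraph N} (h : T.IsTree) (t : N) :
    (T.addLeaf t).IsTree := by
  rw [SimpleGraph.isTree_iff_connected_and_card] at h ⊢
  obtain ⟨hc, hn⟩ := h
  constructor
  · have h1 : (T.induce Set.univ).Connected := (SimpleGraph.induceUnivIso T).connected_iff.mpr hc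
    have h2 := SimpleGraph.addLeaf_induce_insert_none_connected h1 (Set.mem_univ t)
    have he : (insert none (some '' Set.univ) : Set (Option N)) = Set.univ := by
      ext x
      cases x <;> simp
    rw [he] at h2
    exact (SimpleGraph.induceUnivIso _).connected_iff.mp h2
  · have he : (T.addLeaf t).edgeSet = insert s(none, some t) (Sym2.map some '' T.edgeSet) := by
      ext e
      induction e using Sym2.ind with
      | _ a b =>
        simp only [SimpleGraph.mem_edgeSet, Set.mem_insert_iff, Set.mem_image]
        constructor
        · rintro (⟨x, y, h, rfl, rfl⟩ | ⟨rfl, rfl⟩ | ⟨rfl, rfl⟩)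
          · exact Or.inr ⟨s(x, y), h, rfl⟩
          · exact Or.inl rfl
          · exact Or.inl Sym2.eq_swap
        · rintro (h | ⟨e, he, h⟩)
          · rcases Sym2.eq_iff.mp h with ⟨rfl, rfl⟩ | ⟨rfl, rfl⟩
            · exact Or.inr (Or.inl ⟨rfl, rfl⟩)
            · exact Or.inr (Or.inr ⟨rfl, rfl⟩)
          · induction e using Sym2.ind with
            | _ x y =>
              rw [Sym2.map_mk, Sym2.eq_iff] at h
              rcases h with ⟨rfl, rfl⟩ | ⟨rfl, rfl⟩
              · exact Or.inl ⟨x, y, he, rfl, rfl⟩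
              · exact Or.inl ⟨y, x, he.symm, rfl, rfl⟩
    have hnot : s(none, some t) ∉ Sym2.map some '' T.edgeSet := by
      rintro ⟨e, -, h⟩
      have : none ∈ Sym2.map some e := h ▸ Sym2.mem_mk_left _ _
      simp [Sym2.mem_map] at this
    rw [he, Nat.card_coe_set_eq, Set.ncard_insert_of_notMem hnot (Set.toFinite _),
      Set.ncard_image_of_injective _ (Sym2.map.injective (Option.some_injective N)),
      ← Nat.card_coe_set_eq, hn, Finite.card_option]

end LeafExtension

/-! ### Components, boundaries and decompositions by exploration -/

section VertexSets

variable {V : Type*} (G : SimpleGraph V)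

/-- The set of vertices outside `A` with a neighbor in `A`. -/
def SimpleGraph.boundary (A : Set V) : Set V := {x | x ∉ A ∧ ∃ a ∈ A, G.Adj a x}

/-- A set of vertices is linked if it is not the union of two nonempty disjoint parts without
edges between them. -/
def SimpleGraph.IsLinked (C : Set V) : Prop :=
  ∀ A ⊆ C, A.Nonempty → (∀ x ∈ A, ∀ y ∈ C, G.Adj x y → y ∈ A) → A = C

/-- `F` is the vertex set of a connected component of the subgraph induced by `W`. -/
structure SimpleGraph.IsComponentIn (W F : Set V) : Prop where
  nonempty : F.Nonempty
  subset : F ⊆ W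
  linked : G.IsLinked F
  closed : ∀ x ∈ F, ∀ y ∈ W, G.Adj x y → y ∈ F

variable {G}

/-- The component is the least set containing `c` and closed under adjacency in `W`. It is linked: a
closed part avoiding `c` could be removed, leaving a smaller such set. -/
theorem SimpleGraph.exists_isComponentIn {W : Set V} {c : V} (hc : c ∈ W) :
    ∃ F, G.IsComponentIn W F ∧ c ∈ F := by
  let P : Set V → Prop := fun A => c ∈ A ∧ ∀ x ∈ A, ∀ y ∈ W, G.Adj x y → y ∈ A
  let F : Set V := {x ∈ W | ∀ A, P A → x ∈ A}
  have hcF : c ∈ F := ⟨hc, fun A hA => hA.1⟩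
  have hcl : ∀ x ∈ F, ∀ y ∈ W, G.Adj x y → y ∈ F :=
    fun x hx y hy hxy => ⟨hy, fun A hA => hA.2 x (hx.2 A hA) y hy hxy⟩
  refine ⟨F, ⟨⟨c, hcF⟩, fun x hx => hx.1, ?_, hcl⟩, hcF⟩
  intro A hAF hne hA
  by_cases hcA : c ∈ A
  · refine hAF.antisymm fun x hx => hx.2 A ⟨hcA, fun a ha y hy hay => ?_⟩
    exact hA a ha y (hcl a (hAF ha) y hy hay) hay
  · obtain ⟨a, ha⟩ := hne
    have h := (hAF ha).2 (F \ A) ⟨⟨hcF, hcA⟩, fun x hx y hy hxy =>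
      ⟨hcl x hx.1 y hy hxy, fun hyA => hx.2 (hA y hyA x hx.1 hxy.symm)⟩⟩
    exact absurd ha h.2

theorem SimpleGraph.IsLinked.subset_of_closed {C F : Set V} (hC : G.IsLinked C)
    (hne : (C ∩ F).Nonempty) (hF : ∀ x ∈ F, ∀ y ∈ C, G.Adj x y → y ∈ F) : C ⊆ F := by
  have h := hC (C ∩ F) Set.inter_subset_left hne
    (fun x hx y hy hxy => ⟨hy, hF x hx.2 y hy hxy⟩)
  exact Set.inter_eq_left.mp h

theorem SimpleGraph.IsLinked.boundary_inter_nonempty {C D : Set V} (hC : G.IsLinked C)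
    (hD : D ⊆ C) (hne : D.Nonempty) (hDC : D ≠ C) : (G.boundary D ∩ C).Nonempty := by
  by_contra h
  refine hDC (hC D hD hne fun x hx y hy hxy => ?_)
  by_contra hyD
  exact h ⟨y, ⟨hyD, x, hx, hxy⟩, hy⟩

theorem SimpleGraph.IsComponentIn.eq_or_separated {W E F : Set V} (hE : G.IsComponentIn W E)
    (hF : G.IsComponentIn W F) : E = F ∨ ∀ e ∈ E, ∀ f ∈ F, e ≠ f ∧ ¬ G.Adj e f := by
  by_cases hne : (E ∩ F).Nonempty
  · exact Or.inl ((hE.linked.subset_of_closed hne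
      fun x hx y hy => hF.closed x hx y (hE.subset hy)).antisymm
      (hF.linked.subset_of_closed (Set.inter_comm E F ▸ hne)
        fun x hx y hy => hE.closed x hx y (hF.subset hy)))
  · refine Or.inr fun e he f hf => ⟨?_, fun hef => ?_⟩
    · rintro rfl
      exact hne ⟨e, he, hf⟩
    · exact hne ⟨f, hE.closed e he f (hF.subset hf) hef, hf⟩

theorem SimpleGraph.IsLinked.isComponentIn_diff_boundary {C E : Set V} (hE : G.IsLinked E)
    (hne : E.Nonempty) (hEC : E ⊆ C) : G.IsComponentIn (C \ (G.boundary E ∩ C)) E := by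
  refine ⟨hne, fun x hx => ⟨hEC hx, fun h => h.1.1 hx⟩, hE, fun x hx y hy hxy => ?_⟩
  by_contra hyE
  exact hy.2 ⟨⟨hyE, x, hx, hxy⟩, hy.1⟩

/-- A tree decomposition is obtained by repeatedly exploring the components of the unexplored part,
provided each component of the relevant kind contains a nonempty set that can be put in a bag
together with the boundary of the component. -/
theorem exists_treeDecomposition_of_step {V : Type u} [Finite V] {G : SimpleGraph V} {m : ℕ}
    (good : Set V → Prop) (hgood : ∀ F, G.IsComponentIn Set.univ F → good F)
    (hstep : ∀ C, C.Nonempty → G.IsLinked C → good C → ∃ X ⊆ C, X.Nonempty ∧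
      (G.boundary C ∪ X).ncard ≤ m ∧ ∀ F, G.IsComponentIn (C \ X) F → good F) :
    ∃ D : TreeDecomposition G, ∀ t, (D.bag t).card ≤ m := by
  classical
  cases nonempty_fintype V
  -- Invariant: the graph induced by `U` is already decomposed, and each component of the rest is
  -- good with its boundary in a single bag. A maximal such `U` must be everything.
  let P : Set V → Prop := fun U => ∃ (N : Type) (_ : Fintype N) (T : SimpleGraph N)
    (bag : N → Finset V), T.IsTree ∧ (∀ t, (bag t).card ≤ m) ∧ (∀ t, ∀ v ∈ bag t, v ∈ U) ∧
    (∀ u ∈ U, ∀ v ∈ U, G.Adj u v → ∃ t, u ∈ bag t ∧ v ∈ bag t) ∧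
    (∀ v ∈ U, (T.induce {t | v ∈ bag t}).Connected) ∧
    (∀ F, G.IsComponentIn Uᶜ F → good F ∧ ∃ t, ∀ v ∈ G.boundary F, v ∈ bag t)
  have hempty : P ∅ := by
    refine ⟨Unit, inferInstance, ⊥, fun _ => ∅, SimpleGraph.IsTree.of_subsingleton, by simp,
      by simp, by simp, by simp, fun F hF => ?_⟩
    rw [Set.compl_empty] at hF
    exact ⟨hgood F hF, (), fun v ⟨hv, a, ha, hav⟩ => absurd (hF.closed a ha v trivial hav) hv⟩
  have hmax : ∃ U, P U ∧ ∀ U', P U' → U ⊆ U' → U' = U := by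
    obtain ⟨U, hU⟩ := (Set.toFinite {U | P U}).exists_maximal ⟨∅, hempty⟩
    exact ⟨U, hU.prop, fun U' h hle => (hU.eq_of_le h hle).symm⟩
  obtain ⟨U, ⟨N, _, T, bag, hT, hm, hbU, hedge, hconn, hcomp⟩, hUmax⟩ := hmax
  by_cases hU : U = Set.univ
  · subst hU
    exact ⟨{ Node := N
             tree := T
             isTree := hT
             bag := bag
             vertex_mem := fun v => by
               obtain ⟨⟨t, ht⟩⟩ := (hconn v trivial).nonempty
               exact ⟨t, ht⟩
             edge_mem := fun u v => hedge u trivial v trivial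
             connected := fun v => hconn v trivial }, hm⟩
  · exfalso
    obtain ⟨c, hc⟩ := (Set.ne_univ_iff_exists_notMem U).mp hU
    obtain ⟨F, hF, -⟩ := SimpleGraph.exists_isComponentIn (G := G) (W := Uᶜ) hc
    obtain ⟨hFg, t, ht⟩ := hcomp F hF
    obtain ⟨X, hXF, hXne, hXm, hXg⟩ := hstep F hF.nonempty hF.linked hFg
    have hXU : ∀ v ∈ X, v ∉ U := fun v hv => hF.subset (hXF hv)
    have hSU : ∀ v ∈ G.boundary F, v ∈ U := fun v ⟨hv, a, ha, hav⟩ => by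
      by_contra hvU
      exact hv (hF.closed a ha v hvU hav)
    let B : Finset V := (G.boundary F ∪ X).toFinset
    have hB : ∀ v, v ∈ B ↔ v ∈ G.boundary F ∨ v ∈ X := fun v => by simp [B]
    have hBm : B.card ≤ m := by
      rwa [Set.ncard_eq_toFinset_card'] at hXm
    have hP : P (U ∪ X) := by
      -- The new bag `B` hangs on the node `t` whose bag contains the boundary of `F`, so vertices
      -- already placed keep connected subtrees.
      refine ⟨Option N, inferInstance, T.addLeaf t, fun o => o.elim B bag, hT.addLeaf t,
        ?_, ?_, ?_, ?_, ?_⟩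
      · rintro (_ | s)
        exacts [hBm, hm s]
      · rintro (_ | s) v hv
        · exact ((hB v).mp hv).imp (hSU v) id
        · exact Or.inl (hbU s v hv)
      · have key : ∀ u ∈ X, ∀ v ∈ U ∪ X, G.Adj u v → u ∈ B ∧ v ∈ B := by
          rintro u hu v (hv | hv) huv
          · exact ⟨(hB u).mpr (Or.inr hu),
              (hB v).mpr (Or.inl ⟨fun h => hF.subset h hv, u, hXF hu, huv⟩)⟩
          · exact ⟨(hB u).mpr (Or.inr hu), (hB v).mpr (Or.inr hv)⟩
        rintro u (hu | hu) v hv huv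
        · rcases hv with hv | hv
          · obtain ⟨s, hs⟩ := hedge u hu v hv huv
            exact ⟨some s, hs⟩
          · exact ⟨none, (key v hv u (Or.inl hu) huv.symm).symm⟩
        · exact ⟨none, key u hu v hv huv⟩
      · rintro v (hv | hv)
        · by_cases hvS : v ∈ G.boundary F
          · have h := SimpleGraph.addLeaf_induce_insert_none_connected (hconn v hv) (ht v hvS)
            have he : {s : Option N | v ∈ s.elim B bag} = insert none (some '' {s | v ∈ bag s}) := by
              ext (_ | s) <;> simp [hB, hvS]
            rwa [← he] at h
          · have h := SimpleGraph.addLeaf_induce_image_some_connected (t := t) (hconn v hv)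
            have hvX : v ∉ X := fun h => hXU v h hv
            have he : {s : Option N | v ∈ s.elim B bag} = some '' {s | v ∈ bag s} := by
              ext (_ | s) <;> simp [hB, hvS, hvX]
            rwa [← he] at h
        · have he : {s : Option N | v ∈ s.elim B bag} = {none} := by
            ext (_ | s)
            · simp [hB, hv]
            · simpa using fun h => hXU v hv (hbU s v h)
          rw [he]
          exact { preconnected := fun a b => by rw [Subsingleton.elim a b]
                  nonempty := ⟨⟨none, rfl⟩⟩ }
      · intro F' hF'
        have hF'U : ∀ x ∈ F', x ∈ Uᶜ ∧ x ∉ X := fun x hx => by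
          simpa [not_or] using hF'.subset hx
        by_cases hne : (F' ∩ F).Nonempty
        · have hsub : F' ⊆ F := hF'.linked.subset_of_closed hne
            fun x hx y hy hxy => hF.closed x hx y (hF'U y hy).1 hxy
          refine ⟨hXg F' ⟨hF'.nonempty, fun x hx => ⟨hsub hx, (hF'U x hx).2⟩, hF'.linked,
            fun x hx y hy hxy => hF'.closed x hx y ?_ hxy⟩, none, ?_⟩
          · exact fun h => h.elim (hF.subset hy.1) hy.2
          · rintro v ⟨hv, a, ha, hav⟩
            refine (hB v).mpr ?_
            have hvU : v ∈ U ∪ X := by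
              by_contra h
              exact hv (hF'.closed a ha v h hav)
            exact hvU.imp (fun h => ⟨fun hvF => hF.subset hvF h, a, hsub ha, hav⟩) id
        · have hF'' : G.IsComponentIn Uᶜ F' := by
            refine ⟨hF'.nonempty, fun x hx => (hF'U x hx).1, hF'.linked, fun x hx y hy hxy => ?_⟩
            refine hF'.closed x hx y (fun h => h.elim hy fun hyX => hne ⟨x, hx, ?_⟩) hxy
            exact hF.closed y (hXF hyX) x (hF'U x hx).1 hxy.symm
          obtain ⟨h, s, hs⟩ := hcomp F' hF''
          exact ⟨h, some s, hs⟩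
    obtain ⟨x, hx⟩ := hXne
    exact hXU x hx (hUmax _ hP Set.subset_union_left ▸ Or.inr hx)

end VertexSets

/-! ### Boundaries in 1-perfect orientations -/

section Orientation

variable {V : Type*} (D : Digraph V)

/-- The vertices outside `F` with an out-neighbor in `F`. -/
def Digraph.inBoundary (F : Set V) : Set V := {x | x ∉ F ∧ ∃ f ∈ F, D.Adj x f}

/-- The vertices outside `F` with an in-neighbor, but no out-neighbor, in `F`. -/
def Digraph.outBoundary (F : Set V) : Set V :=
  {x | x ∉ F ∧ (∃ f ∈ F, D.Adj f x) ∧ ∀ f ∈ F, ¬ D.Adj x f}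

/-- `D` is an orientation of `G` in which the out-neighborhood of every vertex is a clique. -/
structure IsOnePerfectOrientation {V : Type u} (D : Digraph V) (G : SimpleGraph V) : Prop where
  orientation : IsOrientation D G
  isClique : ∀ v : V, G.IsClique {w | D.Adj v w}

variable {V : Type u} {D : Digraph V} {G : SimpleGraph V}

theorem SimpleGraph.IsClique.ncard_le_cliqueNum [Finite V] {s : Set V}
    (hs : G.IsClique s) : s.ncard ≤ G.cliqueNum := by
  classical
  cases nonempty_fintype V
  rw [Set.ncard_eq_toFinset_card']
  exact SimpleGraph.IsClique.card_le_cliqueNum (tc := by simpa using hs)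

namespace IsOnePerfectOrientation

theorem adj (h : IsOnePerfectOrientation D G)
    {x y : V} (hxy : D.Adj x y) : G.Adj x y :=
  (h.orientation.adj_iff x y).mpr (Or.inl hxy)

theorem boundary_eq (h : IsOnePerfectOrientation D G)
    (F : Set V) : G.boundary F = D.inBoundary F ∪ D.outBoundary F := by
  ext x
  constructor
  · rintro ⟨hx, a, ha, hax⟩
    by_cases hin : ∃ f ∈ F, D.Adj x f
    · exact Or.inl ⟨hx, hin⟩
    · push Not at hin
      refine Or.inr ⟨hx, ⟨a, ha, ?_⟩, hin⟩
      exact ((h.orientation.adj_iff a x).mp hax).resolve_right (hin a ha)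
  · rintro (⟨hx, f, hf, hxf⟩ | ⟨hx, ⟨f, hf, hfx⟩, -⟩)
    · exact ⟨hx, f, hf, (h.adj hxf).symm⟩
    · exact ⟨hx, f, hf, h.adj hfx⟩

/-- Two out-neighbors of `f` are adjacent, and `x` sends nothing into `F`. Hence arcs to `x`
propagate forward along directed paths in `F`. -/
theorem adj_of_outBoundary (h : IsOnePerfectOrientation D G)
    {F : Set V} {x f g : V} (hx : x ∈ D.outBoundary F) (hfx : D.Adj f x)
    (hfg : D.Adj f g) (hg : g ∈ F) : D.Adj g x := by
  have hne : g ≠ x := fun e => hx.1 (e ▸ hg)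
  exact ((h.orientation.adj_iff g x).mp (h.isClique f hfg hfx hne)).resolve_right (hx.2.2 g hg)

/-- The vertices that receive arcs from a linked set but do not send any to it form a clique. -/
theorem isClique_outBoundary (h : IsOnePerfectOrientation D G)
    {F : Set V} (hF : G.IsLinked F) : G.IsClique (D.outBoundary F) := by
  intro x hx y hy hxy
  let r : V → V → Prop := fun p q => D.Adj p q ∧ p ∈ F ∧ q ∈ F
  let R : Set V := {a | ∃ i ∈ F, D.Adj i x ∧ Relation.ReflTransGen r a i}
  -- `R` collects the starts of directed paths in `F` ending at an in-neighbor of `x`. A neighbor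
  -- `b` of `a` either precedes `a` on such a path, or is an out-neighbor of `a`, hence equal or
  -- adjacent to the next vertex of the path, and induction applies.
  have hclosed : ∀ a ∈ R, ∀ b ∈ F, G.Adj a b → b ∈ R := by
    rintro a ⟨i, hi, hix, hai⟩
    induction hai using Relation.ReflTransGen.head_induction_on with
    | refl =>
      intro b hb hib
      rcases (h.orientation.adj_iff i b).mp hib with hib | hbi
      · exact ⟨b, hb, h.adj_of_outBoundary hx hix hib hb, .refl⟩
      · exact ⟨i, hi, hix, .single ⟨hbi, hb, hi⟩⟩
    | @head a c hac hci ih =>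
      intro b hb hab
      rcases (h.orientation.adj_iff a b).mp hab with hab | hba
      · by_cases hcb : c = b
        · exact ⟨i, hi, hix, hcb ▸ hci⟩
        · exact ih b hb (h.isClique a hac.1 hab hcb)
      · exact ⟨i, hi, hix, (hci.head hac).head ⟨hba, hb, hac.2.1⟩⟩
  obtain ⟨i, hi, hix⟩ := hx.2.1
  have hFR : F ⊆ R := hF.subset_of_closed ⟨i, hi, i, hi, hix, .refl⟩ hclosed
  obtain ⟨f, hf, hfy⟩ := hy.2.1
  obtain ⟨j, -, hjx, hfj⟩ := hFR hf
  -- The arc to `y` propagates along the path from `f` to `j`, so `j` sends arcs to both `x` and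
  -- `y`.
  have hjy : D.Adj j y := by
    clear hjx
    induction hfj with
    | refl => exact hfy
    | tail _ hbc ih => exact h.adj_of_outBoundary hy ih hbc.1 hbc.2.2
  exact h.isClique j hjx hjy hxy

theorem adj_of_not_adj (h : IsOnePerfectOrientation D G)
    {x y z : V} (hxz : D.Adj x z) (hxy : G.Adj x y) (hyz : y ≠ z)
    (hnot : ¬ G.Adj y z) : D.Adj y x :=
  ((h.orientation.adj_iff x y).mp hxy).resolve_left
    fun hxy => hnot (h.isClique x hxy hxz hyz)

theorem ncard_boundary_le [Finite V] (h : IsOnePerfectOrientation D G)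
    {F : Set V} (hF : G.IsLinked F)
    (hin : G.IsClique (D.inBoundary F)) : (G.boundary F).ncard ≤ 2 * G.cliqueNum := by
  rw [h.boundary_eq F, two_mul]
  exact (Set.ncard_union_le _ _).trans
    (add_le_add hin.ncard_le_cliqueNum (h.isClique_outBoundary hF).ncard_le_cliqueNum)

/-- A vertex with an out-neighbor in `F` has none in a set `E` separated from `F`. -/
theorem mem_outBoundary_of_separated (h : IsOnePerfectOrientation D G) {E F : Set V} {p : V}
    (hsep : ∀ e ∈ E, ∀ f ∈ F, e ≠ f ∧ ¬ G.Adj e f) (hpF : p ∈ D.inBoundary F)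
    (hpE : p ∈ G.boundary E) : p ∈ D.outBoundary E := by
  rw [h.boundary_eq E] at hpE
  refine hpE.resolve_left fun hp => ?_
  obtain ⟨-, f, hf, hpf⟩ := hpF
  obtain ⟨-, e, he, hpe⟩ := hp
  exact (hsep e he f hf).2 (h.isClique p hpe hpf (hsep e he f hf).1)

theorem mem_boundary_of_mem_inBoundary (h : IsOnePerfectOrientation D G) {C E F : Set V} {p : V}
    (hF : G.IsComponentIn (C \ (G.boundary E ∩ C)) F) (hp : p ∈ D.inBoundary F) (hpC : p ∈ C) :
    p ∈ G.boundary E := by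
  by_contra hpE
  obtain ⟨hpF, f, hf, hpf⟩ := hp
  exact hpF (hF.closed f hf p ⟨hpC, fun hx => hpE hx.1⟩ (h.adj hpf).symm)

/-! ### Separators of size controlled by the clique number -/

/-- If some boundary vertex of `C` is not complete to `C`, the separator is the part in `C` of the
boundary of an inclusion-maximal component of the non-neighbors in `C` of a boundary vertex. -/
theorem exists_separator_of_not_adj [Finite V] (h : IsOnePerfectOrientation D G)
    {C : Set V} (hC : G.IsLinked C)
    (hin : G.IsClique (D.inBoundary C)) {y₀ c₀ : V} (hy₀ : y₀ ∈ G.boundary C) (hc₀ : c₀ ∈ C)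
    (hyc₀ : ¬ G.Adj y₀ c₀) :
    ∃ X ⊆ C, X.Nonempty ∧ (G.boundary C ∪ X).ncard ≤ 4 * G.cliqueNum ∧
      ∀ F, G.IsComponentIn (C \ X) F → G.IsClique (D.inBoundary F) := by
  let 𝒟 : Set (Set V) := {E | ∃ y ∈ G.boundary C, G.IsComponentIn {c ∈ C | ¬ G.Adj y c} E}
  obtain ⟨E, hmax⟩ : ∃ E, Maximal (· ∈ 𝒟) E := by
    obtain ⟨E, hE, -⟩ := SimpleGraph.exists_isComponentIn (G := G)
      (W := {c ∈ C | ¬ G.Adj y₀ c}) ⟨hc₀, hyc₀⟩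
    exact (Set.toFinite 𝒟).exists_maximal ⟨E, y₀, hy₀, hE⟩
  obtain ⟨y, hy, hE⟩ := hmax.prop
  have hEC : E ⊆ C := fun e he => (hE.subset he).1
  have hyE : ∀ e ∈ E, e ≠ y ∧ ¬ G.Adj e y := fun e he =>
    ⟨fun hey => hy.1 (hey ▸ hEC he), fun hey => (hE.subset he).2 hey.symm⟩
  -- Such a `z` has no neighbor in `E`, so by maximality `E` is also a component of its
  -- non-neighbors in `C`; a `t` not adjacent to `z` would then belong to `E`.
  have hfull : ∀ z ∈ G.boundary C, z ∉ G.boundary E → ∀ t ∈ G.boundary E, t ∈ C → G.Adj z t := by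
    rintro z hz hzE t ⟨htE, e, he, het⟩ htC
    by_contra hzt
    have hsub : E ⊆ {c ∈ C | ¬ G.Adj z c} := fun x hx =>
      ⟨hEC hx, fun hzx => hzE ⟨fun hzE' => hz.1 (hEC hzE'), x, hx, hzx.symm⟩⟩
    obtain ⟨E', hE', heE'⟩ := SimpleGraph.exists_isComponentIn (G := G) (hsub he)
    have hle : E ⊆ E' := hE.linked.subset_of_closed ⟨e, he, heE'⟩
      fun a ha b hb => hE'.closed a ha b (hsub hb)
    have heq : E = E' := hmax.eq_of_le ⟨z, hz, hE'⟩ hle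
    exact htE (heq ▸ hE'.closed e heE' t ⟨htC, hzt⟩ het)
  have hyp : ∀ p ∈ D.inBoundary E, G.Adj p y → D.Adj y p := by
    rintro p ⟨-, e, he, hpe⟩ hpy
    exact h.adj_of_not_adj hpe hpy (hyE e he).1.symm fun h' => (hyE e he).2 h'.symm
  have hpC : ∀ p ∈ D.inBoundary E, p ∈ C → D.Adj y p := by
    rintro p hp hpC
    refine hyp p hp ?_
    by_contra hpy
    obtain ⟨hpE, e, he, hpe⟩ := hp
    exact hpE (hE.closed e he p ⟨hpC, fun h' => hpy h'.symm⟩ (h.adj hpe).symm)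
  have hmono : ∀ F ⊆ C, ∀ p ∈ D.inBoundary F, p ∉ C → p ∈ D.inBoundary C := by
    rintro F hFC p ⟨-, f, hf, hpf⟩ hpC
    exact ⟨hpC, f, hFC hf, hpf⟩
  -- If `y` sends an arc into `C`, all these vertices are out-neighbors of `y`. Otherwise none of
  -- them lies in `C`, since `y` would send it an arc, and they all belong to the clique
  -- `D.inBoundary C`.
  have hinE : G.IsClique (D.inBoundary E) := by
    by_cases hyin : y ∈ D.inBoundary C
    · refine (h.isClique y).subset fun p hp => ?_
      by_cases hp' : p ∈ C
      · exact hpC p hp hp'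
      · refine hyp p hp (hin (hmono E hEC p hp hp') hyin ?_)
        rintro rfl
        obtain ⟨-, e, he, hpe⟩ := hp
        exact (hyE e he).2 (h.adj hpe).symm
    · refine hin.subset fun p hp => hmono E hEC p hp fun hp' => hyin ⟨hy.1, p, hp', hpC p hp hp'⟩
  refine ⟨G.boundary E ∩ C, Set.inter_subset_right, ?_, ?_, ?_⟩
  · refine hC.boundary_inter_nonempty hEC hE.nonempty ?_
    rintro rfl
    obtain ⟨c, hc, hcy⟩ := hy.2
    exact (hyE c hc).2 hcy
  · calc (G.boundary C ∪ G.boundary E ∩ C).ncard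
        ≤ (G.boundary C).ncard + (G.boundary E ∩ C).ncard := Set.ncard_union_le _ _
      _ ≤ (G.boundary C).ncard + (G.boundary E).ncard :=
          Nat.add_le_add_left (Set.ncard_le_ncard Set.inter_subset_left) _
      _ ≤ 2 * G.cliqueNum + 2 * G.cliqueNum :=
          add_le_add (h.ncard_boundary_le hC hin) (h.ncard_boundary_le hE.linked hinE)
      _ = 4 * G.cliqueNum := by ring
  · intro F hF
    have hFC : F ⊆ C := fun f hf => (hF.subset hf).1
    rcases (hE.linked.isComponentIn_diff_boundary hE.nonempty hEC).eq_or_separated hF with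
      rfl | hsep
    · exact hinE
    have hout : ∀ p ∈ D.inBoundary F, p ∈ G.boundary E → p ∈ D.outBoundary E :=
      fun p hp hpE => h.mem_outBoundary_of_separated hsep hp hpE
    -- If `q` is in the boundary of `E`, both only receive arcs from `E`; otherwise `hfull` applies
    -- to `q`.
    have hmixed : ∀ p ∈ D.inBoundary F, ∀ q ∈ D.inBoundary F, p ≠ q → p ∈ C → q ∉ C →
        G.Adj p q := by
      intro p hp q hq hpq hpC hqC
      have hpE := h.mem_boundary_of_mem_inBoundary hF hp hpC
      by_cases hqE : q ∈ G.boundary E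
      · exact h.isClique_outBoundary hE.linked (hout p hp hpE) (hout q hq hqE) hpq
      · refine (hfull q ?_ hqE p hpE hpC).symm
        exact h.boundary_eq C ▸ Or.inl (hmono F hFC q hq hqC)
    intro p hp q hq hpq
    by_cases hpC : p ∈ C <;> by_cases hqC : q ∈ C
    · exact h.isClique_outBoundary hE.linked
        (hout p hp (h.mem_boundary_of_mem_inBoundary hF hp hpC))
        (hout q hq (h.mem_boundary_of_mem_inBoundary hF hq hqC)) hpq
    · exact hmixed p hp q hq hpq hpC hqC
    · exact (hmixed q hq p hp hpq.symm hqC hpC).symm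
    · exact hin (hmono F hFC p hp hpC) (hmono F hFC q hq hqC) hpq

/-- If the boundary of `C` is complete to `C`, the separator is `C` itself when `C` is a clique, and
otherwise the boundary in `C` of a component of the non-neighbors in `C` of some vertex of `C`. -/
theorem exists_separator_of_complete [Finite V] (h : IsOnePerfectOrientation D G)
    {C : Set V} (hne : C.Nonempty) (hC : G.IsLinked C)
    (hin : G.IsClique (D.inBoundary C)) (hcomplete : ∀ y ∈ G.boundary C, ∀ c ∈ C, G.Adj y c) :
    ∃ X ⊆ C, X.Nonempty ∧ (G.boundary C ∪ X).ncard ≤ 4 * G.cliqueNum ∧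
      ∀ F, G.IsComponentIn (C \ X) F → G.IsClique (D.inBoundary F) := by
  have hbd := h.ncard_boundary_le hC hin
  by_cases hcl : G.IsClique C
  · refine ⟨C, subset_rfl, hne, ?_, fun F hF => ?_⟩
    · have h1 := hcl.ncard_le_cliqueNum
      have h2 := Set.ncard_union_le (G.boundary C) C
      omega
    · obtain ⟨f, hf⟩ := hF.nonempty
      exact absurd (hF.subset hf).1 (hF.subset hf).2
  obtain ⟨u, hu, v, hv, huv, hnadj⟩ : ∃ u ∈ C, ∃ v ∈ C, u ≠ v ∧ ¬ G.Adj u v := by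
    simpa [SimpleGraph.IsClique, Set.Pairwise] using hcl
  obtain ⟨E, hE, -⟩ := SimpleGraph.exists_isComponentIn (G := G)
    (W := {c ∈ C | u ≠ c ∧ ¬ G.Adj u c}) ⟨hv, huv, hnadj⟩
  have hEC : E ⊆ C := fun e he => (hE.subset he).1
  -- Only the part in `C` is controlled: its vertices are out-neighbors of `u`. Pairs with a vertex
  -- outside `C` are handled by completeness or by `hin`.
  have hXin : G.IsClique (G.boundary E ∩ C ∩ D.inBoundary E) := by
    refine (h.isClique u).subset ?_
    rintro p ⟨⟨-, hpC⟩, hpE, e, he, hpe⟩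
    have hue := (hE.subset he).2
    refine h.adj_of_not_adj hpe ?_ hue.1 hue.2
    by_contra hpu
    refine hpE (hE.closed e he p ⟨hpC, ?_, fun h' => hpu h'.symm⟩ (h.adj hpe).symm)
    rintro rfl
    exact hue.2 (h.adj hpe)
  refine ⟨G.boundary E ∩ C, Set.inter_subset_right, ?_, ?_, ?_⟩
  · refine hC.boundary_inter_nonempty hEC hE.nonempty ?_
    rintro rfl
    exact (hE.subset hu).2.1 rfl
  · have hX : G.boundary E ∩ C ⊆ (G.boundary E ∩ C ∩ D.inBoundary E) ∪ D.outBoundary E := by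
      intro p hp
      have hpE := h.boundary_eq E ▸ hp.1
      exact hpE.imp (fun hpE => ⟨hp, hpE⟩) id
    have h1 := Set.ncard_le_ncard hX
    have h2 := Set.ncard_union_le (G.boundary E ∩ C ∩ D.inBoundary E) (D.outBoundary E)
    have h3 := hXin.ncard_le_cliqueNum
    have h4 := (h.isClique_outBoundary hE.linked).ncard_le_cliqueNum
    have h5 := Set.ncard_union_le (G.boundary C) (G.boundary E ∩ C)
    omega
  · intro F hF
    have hFC : F ⊆ C := fun f hf => (hF.subset hf).1
    have hmono : ∀ p ∈ D.inBoundary F, p ∉ C → p ∈ D.inBoundary C := by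
      rintro p ⟨-, f, hf, hpf⟩ hpC
      exact ⟨hpC, f, hFC hf, hpf⟩
    have hbdC : ∀ p ∈ D.inBoundary F, p ∉ C → p ∈ G.boundary C :=
      fun p hp hpC => h.boundary_eq C ▸ Or.inl (hmono p hp hpC)
    intro p hp q hq hpq
    by_cases hpC : p ∈ C <;> by_cases hqC : q ∈ C
    · have hpE := h.mem_boundary_of_mem_inBoundary hF hp hpC
      have hqE := h.mem_boundary_of_mem_inBoundary hF hq hqC
      rcases (hE.linked.isComponentIn_diff_boundary hE.nonempty hEC).eq_or_separated hF with
        rfl | hsep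
      · exact hXin ⟨⟨hpE, hpC⟩, hp⟩ ⟨⟨hqE, hqC⟩, hq⟩ hpq
      · exact h.isClique_outBoundary hE.linked (h.mem_outBoundary_of_separated hsep hp hpE)
          (h.mem_outBoundary_of_separated hsep hq hqE) hpq
    · exact (hcomplete q (hbdC q hq hqC) p hpC).symm
    · exact hcomplete p (hbdC p hp hpC) q hqC
    · exact hin (hmono p hp hpC) (hmono q hq hqC) hpq

theorem exists_treeDecomposition [Finite V] (h : IsOnePerfectOrientation D G) :
    ∃ T : TreeDecomposition G, ∀ t, (T.bag t).card ≤ 4 * G.cliqueNum := by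
  refine exists_treeDecomposition_of_step (fun F => G.IsClique (D.inBoundary F)) ?_ ?_
  · rintro F hF p ⟨hp, f, hf, hpf⟩
    exact absurd (hF.closed f hf p trivial (h.adj hpf).symm) hp
  · intro C hne hC hin
    by_cases hcomplete : ∀ y ∈ G.boundary C, ∀ c ∈ C, G.Adj y c
    · exact h.exists_separator_of_complete hne hC hin hcomplete
    · push Not at hcomplete
      obtain ⟨y, hy, c, hc, hyc⟩ := hcomplete
      exact h.exists_separator_of_not_adj hC hin hy hc hyc

/-- A 1-perfectly orientable graph has treewidth at most `4 ω - 1`. -/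
theorem treewidth_le [Finite V] (h : IsOnePerfectOrientation D G) :
    treewidth G ≤ 4 * G.cliqueNum - 1 := by
  obtain ⟨T, hT⟩ := h.exists_treeDecomposition
  refine ((treewidth_isLeast G).2 ⟨T, rfl⟩).trans (Nat.sub_le_sub_right ?_ 1)
  exact Finset.sup_le fun t _ => hT t

theorem induce (h : IsOnePerfectOrientation D G) (s : Set V) :
    IsOnePerfectOrientation (⟨fun a b => D.Adj a b⟩ : Digraph s) (G.induce s) where
  orientation :=
    { adj_iff := fun a b => h.orientation.adj_iff a b
      asymm := fun a b => h.orientation.asymm a b }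
  isClique v _ ha _ hb hab := h.isClique v ha hb fun e => hab (Subtype.ext e)

end IsOnePerfectOrientation

end Orientation

/-! ### The Ramsey lower bound and the conclusion -/

/-- The disjoint union of two complete graphs on `k` vertices has neither a clique of size `k + 1`
nor an independent set of size `3`. -/
theorem two_mul_lt_ramseyNumber (k : ℕ) : 2 * k < ramseyNumber (k + 1) 3 := by
  classical
  by_contra! hle
  let G : SimpleGraph (Fin k × Bool) :=
    { Adj := fun a b => a ≠ b ∧ a.2 = b.2
      symm := ⟨fun _ _ hab => ⟨hab.1.symm, hab.2.symm⟩⟩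
      loopless := ⟨fun _ ha => ha.1 rfl⟩ }
  rcases (ramseyNumber_isLeast (k + 1) 3).1.2 (Fin k × Bool) G (by simpa [mul_comm] using hle) with
    ⟨s, hs⟩ | ⟨s, hs⟩
  · have hcard : s.card ≤ (Finset.univ : Finset (Fin k)).card :=
      Finset.card_le_card_of_injOn Prod.fst (fun _ _ => Finset.mem_coe.mpr (Finset.mem_univ _))
        fun _ ha _ hb hab => by
          by_contra hne
          exact hne (Prod.ext hab (hs.isClique ha hb hne).2)
    rw [hs.card_eq, Finset.card_univ, Fintype.card_fin] at hcard
    omega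
  · have hcard : s.card ≤ (Finset.univ : Finset Bool).card :=
      Finset.card_le_card_of_injOn Prod.snd (fun _ _ => Finset.mem_coe.mpr (Finset.mem_univ _))
        fun _ ha _ hb hab => by
          by_contra hne
          exact hs.isIndepSet ha hb hne ⟨hne, hab⟩
    rw [hs.card_eq] at hcard
    simp at hcard

theorem mainTheorem8 :
    IsTwOmegaBounded.{u} IsOnePerfectlyOrientable ∧
      IsTwOmegaBindingFunction.{u} IsOnePerfectlyOrientable
        (fun k : ℕ => max k (2 * ramseyNumber (k + 1) 3 - 2) - 1) := by
  have hbind : IsTwOmegaBindingFunction.{u} IsOnePerfectlyOrientable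
      (fun k : ℕ => max k (2 * ramseyNumber (k + 1) 3 - 2) - 1) := by
    rintro V _ G ⟨D, hD, hcl⟩ s
    refine ((IsOnePerfectOrientation.mk hD hcl).induce s).treewidth_le.trans
      (Nat.sub_le_sub_right (le_max_of_le_right ?_) 1)
    -- From `2ω + 1 ≤ R(ω+1,3)` follows `4ω ≤ 2R(ω+1,3) - 2`, also for `ω = 0`.
    have hR := two_mul_lt_ramseyNumber (G.induce s).cliqueNum
    omega
  exact ⟨⟨_, hbind⟩, hbind⟩
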